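/- Let $T\ge 1$ be the number of tokens. A query $q=(q_1,\dots,q_{\mathrm{len}(q)})$ and a document $d=(d_1,\dots,d_{\mathrm{len}(d)})$ are nonempty finite sequences of tokens in $[T]$; a query encoder and a document encoder assign to every position a (possibly context-dependent) vector $E_q(q_i)$, $E_d(d_j)$ in $\mathbb{R}^m$. For $w\in\mathbb{R}^T$ the Weighted Chamfer score is $$\eta_w(q,d)=\frac{1}{\mathrm{len}(q)}\sum_{i=1}^{\mathrm{len}(q)} w_{q_i}\,\min_{j\in[\mathrm{len}(d)]}\|E_q(q_i)-E_d(d_j)\|_2,$$ and $$\mathcal{H}=\{(q,d)\mapsto \mathbb{I}[\eta_w(q,d)\ge\tau] \mid w\in\mathbb{R}^T,\ \tau\in\mathbb{R}\}.$$ Let $\mathfrak{D}$ be a probability distribution on labelled pairs $(x,y)$, where $x=(q,d)$ is a query-document pair and $y\in\{0,1\}$ is its relevance label, and let $\ell((x,y),h)=\ell((x,y),h(x))$ be a real loss that depends on $h$ through the prediction $h(x)\in\{0,1\}$, is $1$-Lipschitz in it, and is $\mathfrak{D}$-integrable for each of the two predictions (for instance the $0$-$1$ loss). Put $L(h)=\mathbb{E}_{(x,y)\sim\mathfrak{D}}[\ell((x,y),h)]$,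 and for a sample $(x^{(i)},y^{(i)})_{i=1}^n$ put $\hat L(h)=\frac1n\sum_{i=1}^n \ell((x^{(i)},y^{(i)}),h)$. For every $\varepsilon_0<1$ there is a constant $C>0$, depending only on $\varepsilon_0$, such that for all $T$, $m$, encoders, $\mathfrak{D}$ and $\ell$ as above, all $\varepsilon\in(0,\varepsilon_0]\cup[1,\infty)$, all $\delta\in(0,1)$ and all integers $n \ge 0$ with $$n\ \ge\ C\,\frac{T\log(1/\varepsilon)+\log(1/\delta)}{\varepsilon^2},$$ the following holds with probability at least $1-\delta$ over an i.i.d. sample of size $n$ from $\mathfrak{D}$: every empirical risk minimizer $\hat h\in\arg\min_{h\in\mathcal{H}}\hat L(h)$ satisfies $|L(\hat h)-\inf_{h\in\mathcal{H}}L(h)|\le\varepsilon$; in particular $|L(\hat h)-L(h^*)|\le\varepsilon$ for every $h^*\in\arg\min_{h\in\mathcal{H}}L(h)$. -/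

import Mathlib

open MeasureTheory

noncomputable section

namespace WeightedChamfer

/-- A query or a document: a nonempty finite sequence of tokens from the universe `[T]`. -/
def TokenSeq (T : ℕ) : Type := {l : List (Fin T) // l ≠ []}

namespace TokenSeq

variable {T : ℕ}

/-- The number of tokens. -/
def len (s : TokenSeq T) : ℕ := s.1.length

/-- The token at position `i`. -/
def token (s : TokenSeq T) (i : Fin s.len) : Fin T := s.1.get i

end TokenSeq

instance (T : ℕ) : Countable (TokenSeq T) :=
  inferInstanceAs (Countable {l : List (Fin T) // l ≠ []})

/-- The countable set of token sequences carries the discrete σ-algebra. -/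
instance (T : ℕ) : MeasurableSpace (TokenSeq T) := ⊤

instance (T : ℕ) : DiscreteMeasurableSpace (TokenSeq T) := ⟨fun _ => trivial⟩

/-- A token-level encoder into `ℝ^m`: one embedding vector for each position of the sequence.
The vector at a position may depend on the whole sequence (contextual embedding). -/
abbrev Encoder (T m : ℕ) : Type := (s : TokenSeq T) → Fin s.len → EuclideanSpace ℝ (Fin m)

/-- The Weighted Chamfer distance
`η_w(q,d) = (1 / len q) ∑ᵢ w_{qᵢ} · min_j ‖E_q(qᵢ) - E_d(d_j)‖₂`
(the infimum is over a nonempty finite set, hence a minimum). -/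
def weightedChamfer {T m : ℕ} (encQ encD : Encoder T m) (w : Fin T → ℝ) (q d : TokenSeq T) : ℝ :=
  (1 / (q.len : ℝ)) * ∑ i : Fin q.len, w (q.token i) * ⨅ j : Fin d.len, ‖encQ q i - encD d j‖

/-- The class of all classifiers `(q,d) ↦ 𝟙[η_w(q,d) ≥ τ]` with `w ∈ ℝ^T` and `τ ∈ ℝ`. -/
def hypothesisClass {T m : ℕ} (encQ encD : Encoder T m) : Set (TokenSeq T × TokenSeq T → Bool) :=
  {h | ∃ (w : Fin T → ℝ) (τ : ℝ), ∀ q d, h (q, d) = true ↔ weightedChamfer encQ encD w q d ≥ τ}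

/-- Expected risk `L(h) = E_{(x,y) ∼ P} [ℓ((x,y), h(x))]`. -/
def expectedRisk {X : Type*} [MeasurableSpace X] (loss : X × Bool → Bool → ℝ)
    (P : Measure (X × Bool)) (h : X → Bool) : ℝ :=
  ∫ z, loss z (h z.1) ∂P

/-- Empirical risk `(1/n) ∑ᵢ ℓ((xᵢ,yᵢ), h(xᵢ))` on the sample `S`. -/
def empiricalRisk {X : Type*} (loss : X × Bool → Bool → ℝ) {n : ℕ} (S : Fin n → X × Bool)
    (h : X → Bool) : ℝ :=
  (1 / (n : ℝ)) * ∑ i, loss (S i) (h (S i).1)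

/-- `h ∈ argmin_{g ∈ H} R g`. -/
def IsRiskMinimizer {X : Type*} (H : Set (X → Bool)) (R : (X → Bool) → ℝ) (h : X → Bool) : Prop :=
  h ∈ H ∧ ∀ g ∈ H, R h ≤ R g

end WeightedChamfer

end

open MeasureTheory

noncomputable section

namespace WeightedChamfer

/-! The score is linear in `w`, so every classifier is a half-space `0 ≤ f (φ x)` in dimension `T +
1`, where the extra constant coordinate carries `τ`. Linear dependence bounds the VC dimension by `T
+ 1` (`card_le_finrank_of_shatters`), and Sauer–Shelah bounds the number of traces on `2n` points
(`card_traces_le`).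

Uniform convergence follows by symmetrization. The exponential deviation is compared with that of a
ghost sample (Jensen), averaged over random swaps, bounded by a sum over the finitely many patterns,
and passed to Markov's inequality (`measure_exists_deviation_le`). The sample space is countable and
discrete, so suprema over the uncountable class are measurable.

Only the excess of a prediction over `false` is controlled: the remaining part of the loss, possibly
unbounded, is common to all hypotheses and cancels. For `1 ≤ ε` the claim is deterministic, since
two risks differ by at most 1; for `ε ≤ ε₀ < 1`, `log (1 / ε)` is bounded below and absorbs the
numerical constants. -/

/-! ### Growth function of a class of half-spaces -/

/-- The subsets of `ι` cut out by the class `H` along the points `x`. -/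
def traces {X ι : Type*} [Fintype ι] (H : Set (X → Bool)) (x : ι → X) : Finset (Finset ι) := by
  classical
  exact Finset.univ.filter fun s => ∃ h ∈ H, ∀ i, i ∈ s ↔ h (x i) = true

lemma mem_traces {X ι : Type*} [Fintype ι] {H : Set (X → Bool)} {x : ι → X} {s : Finset ι} :
    s ∈ traces H x ↔ ∃ h ∈ H, ∀ i, i ∈ s ↔ h (x i) = true := by
  classical
  simp [traces]

/-- A set shattered by half-spaces of a finite-dimensional space `E` has at most `dim E` points. -/
lemma card_le_finrank_of_shatters {X ι E : Type*} [Fintype ι] [DecidableEq ι] [AddCommGroup E]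
    [Module ℝ E] [Module.Finite ℝ E] {H : Set (X → Bool)} (φ : X → E)
    (hH : ∀ h ∈ H, ∃ f : E →ₗ[ℝ] ℝ, ∀ x, h x = true ↔ 0 ≤ f (φ x)) (x : ι → X) {s : Finset ι}
    (hs : (traces H x).Shatters s) : s.card ≤ Module.finrank ℝ E := by
  by_contra hlt
  have hdep : ¬ LinearIndependent ℝ (fun i : s => φ (x i)) := fun hli =>
    hlt (by simpa using hli.fintype_card_le_finrank)
  obtain ⟨c, hc, i₀, hi₀⟩ := Fintype.not_linearIndependent_iff.1 hdep
  -- The half-spaces are closed, so only a point outside is sure to have `f ≠ 0`; hence a negative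
  -- coefficient is needed.
  obtain ⟨a, ha, hneg⟩ : ∃ a : s → ℝ, ∑ i, a i • φ (x i) = 0 ∧ a i₀ < 0 := by
    rcases lt_or_gt_of_ne hi₀ with h | h
    · exact ⟨c, hc, h⟩
    · exact ⟨-c, by simp only [Pi.neg_apply, neg_smul, Finset.sum_neg_distrib, hc, neg_zero], by simpa using h⟩
  -- Cutting out the nonnegative coefficients makes every `a i * f (φ (x i))` nonnegative, with the
  -- term at `i₀` strictly positive, although the terms sum to zero.
  obtain ⟨u, hu, hsu⟩ := hs (t := s.filter fun i => ∃ hi : i ∈ s, 0 ≤ a ⟨i, hi⟩)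
    (Finset.filter_subset _ _)
  obtain ⟨h, hh, hhu⟩ := mem_traces.1 hu
  obtain ⟨f, hf⟩ := hH h hh
  have key : ∀ i : s, 0 ≤ f (φ (x i)) ↔ 0 ≤ a i := by
    intro i
    rw [← hf, ← hhu]
    have := congrArg (fun t => (i : ι) ∈ t) hsu
    simpa [i.2] using this
  have hsum : ∑ i : s, a i * f (φ (x i)) = 0 := by
    have := congrArg f ha
    simpa [map_sum] using this
  have hnn : ∀ i : s, 0 ≤ a i * f (φ (x i)) := by
    intro i
    by_cases hi : 0 ≤ a i
    · exact mul_nonneg hi ((key i).2 hi)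
    · exact mul_nonneg_of_nonpos_of_nonpos (le_of_not_ge hi)
        (le_of_not_ge fun h' => hi ((key i).1 h'))
  have hz := (Finset.sum_eq_zero_iff_of_nonneg fun i _ => hnn i).1 hsum i₀ (Finset.mem_univ _)
  have hlt₀ : f (φ (x i₀)) < 0 := lt_of_not_ge fun h' => not_le.2 hneg ((key i₀).1 h')
  exact (mul_pos_of_neg_of_neg hneg hlt₀).ne' hz

/-- Each term is weighted by `t ^ (k - D) ≥ 1` before applying the binomial theorem. The free `t` is
later of order `ε ^ 2`, so that `exp (N * t)` is absorbed by the concentration exponent. -/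
lemma sum_choose_le (N D : ℕ) {t : ℝ} (ht : 0 < t) (ht1 : t ≤ 1) :
    ∑ k ∈ Finset.Iic D, (N.choose k : ℝ) ≤ (1 / t) ^ D * Real.exp (N * t) := by
  have h1 : ∑ k ∈ Finset.Iic D, (N.choose k : ℝ) ≤
      (1 / t) ^ D * ∑ k ∈ Finset.Iic D, t ^ k * (N.choose k : ℝ) := by
    rw [Finset.mul_sum]
    refine Finset.sum_le_sum fun k hk => ?_
    have hk' : k ≤ D := Finset.mem_Iic.1 hk
    have h2 : 1 ≤ (1 / t) ^ D * t ^ k := by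
      rw [one_div, inv_pow, inv_mul_eq_div, one_le_div (by positivity)]
      exact pow_le_pow_of_le_one ht.le ht1 hk'
    rw [← mul_assoc]
    exact le_mul_of_one_le_left (by positivity) h2
  have h3 : ∑ k ∈ Finset.Iic D, t ^ k * (N.choose k : ℝ) ≤ (t + 1) ^ N := by
    rw [add_pow]
    simp only [one_pow, mul_one]
    rw [← Finset.sum_filter_add_sum_filter_not (Finset.Iic D) (fun k => k ≤ N)]
    have h4 : ∑ k ∈ (Finset.Iic D).filter (fun k => ¬ k ≤ N), t ^ k * (N.choose k : ℝ) = 0 :=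
      Finset.sum_eq_zero fun k hk => by
        rw [Nat.choose_eq_zero_of_lt (not_le.1 (Finset.mem_filter.1 hk).2)]; simp
    rw [h4, add_zero]
    refine Finset.sum_le_sum_of_subset_of_nonneg (fun k hk => ?_) fun k _ _ => by positivity
    exact Finset.mem_range.2 (Nat.lt_succ_of_le (Finset.mem_filter.1 hk).2)
  have h5 : (t + 1) ^ N ≤ Real.exp (N * t) := by
    rw [Real.exp_nat_mul]
    exact pow_le_pow_left₀ (by positivity) (Real.add_one_le_exp t) N
  exact h1.trans (mul_le_mul_of_nonneg_left (h3.trans h5) (by positivity))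

lemma card_traces_le {X ι E : Type*} [Fintype ι] [AddCommGroup E]
    [Module ℝ E] [Module.Finite ℝ E] {H : Set (X → Bool)} (φ : X → E)
    (hH : ∀ h ∈ H, ∃ f : E →ₗ[ℝ] ℝ, ∀ x, h x = true ↔ 0 ≤ f (φ x)) (x : ι → X)
    {t : ℝ} (ht : 0 < t) (ht1 : t ≤ 1) :
    ((traces H x).card : ℝ) ≤
      (1 / t) ^ Module.finrank ℝ E * Real.exp (Fintype.card ι * t) := by
  classical
  have hvc : (traces H x).vcDim ≤ Module.finrank ℝ E :=
    Finset.sup_le fun s hs => card_le_finrank_of_shatters φ hH x (Finset.mem_shatterer.1 hs)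
  have h1 : (traces H x).card ≤
      ∑ k ∈ Finset.Iic (Module.finrank ℝ E), (Fintype.card ι).choose k :=
    (Finset.card_le_card_shatterer _).trans <| Finset.card_shatterer_le_sum_vcDim.trans <|
      Finset.sum_le_sum_of_subset (Finset.Iic_subset_Iic.2 hvc)
  refine le_trans ?_ (sum_choose_le (Fintype.card ι) (Module.finrank ℝ E) ht ht1)
  exact_mod_cast h1

/-! ### Symmetrization -/

/-- The sign attached to a Boolean. -/
def sgn (b : Bool) : ℝ := if b then -1 else 1

/-- The sum over signs factors into hyperbolic cosines, and `cosh x ≤ exp (x ^ 2 / 2)`. -/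
lemma sum_exp_sgn_le {n : ℕ} (a : Fin n → ℝ) (ha : ∀ i, |a i| ≤ 2) (l : ℝ) :
    ∑ s : Fin n → Bool, Real.exp (l * ∑ i, sgn (s i) * a i) ≤
      2 ^ n * Real.exp (2 * n * l ^ 2) := by
  have h1 : ∑ s : Fin n → Bool, Real.exp (l * ∑ i, sgn (s i) * a i) =
      ∏ i, (2 * Real.cosh (l * a i)) := by
    have h2 := Fintype.prod_sum (fun (i : Fin n) (b : Bool) => Real.exp (l * (sgn b * a i)))
    simp only [Fintype.sum_bool] at h2
    simp only [Finset.mul_sum, Real.exp_sum]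
    rw [← h2]
    refine Finset.prod_congr rfl fun i _ => ?_
    rw [Real.cosh_eq]
    simp only [sgn]
    simp
    ring
  have h3 : ∀ i, 2 * Real.cosh (l * a i) ≤ 2 * Real.exp (2 * l ^ 2) := by
    intro i
    refine mul_le_mul_of_nonneg_left ((Real.cosh_le_exp_half_sq _).trans ?_) (by norm_num)
    refine Real.exp_le_exp.2 ?_
    have h4 : a i ^ 2 ≤ 2 ^ 2 := sq_le_sq' (by linarith [(abs_le.1 (ha i)).1]) (abs_le.1 (ha i)).2
    have := mul_le_mul_of_nonneg_left h4 (sq_nonneg l)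
    rw [mul_pow]; linarith
  rw [h1]
  refine (Finset.prod_le_prod (fun i _ => by positivity) fun i _ => h3 i).trans_eq ?_
  simp only [Finset.prod_const, Finset.card_univ, Fintype.card_fin, mul_pow]
  rw [← Real.exp_nat_mul]
  congr 2; ring

lemma sum_exp_abs_sgn_le {n : ℕ} (a : Fin n → ℝ) (ha : ∀ i, |a i| ≤ 2) (l : ℝ) :
    ∑ s : Fin n → Bool, Real.exp (l * |∑ i, sgn (s i) * a i|) ≤
      2 ^ n * (2 * Real.exp (2 * n * l ^ 2)) := by
  have h1 := sum_exp_sgn_le a ha l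
  have h2 := sum_exp_sgn_le a ha (-l)
  have h3 : ∀ s : Fin n → Bool, Real.exp (l * |∑ i, sgn (s i) * a i|) ≤
      Real.exp (l * ∑ i, sgn (s i) * a i) + Real.exp (-l * ∑ i, sgn (s i) * a i) := by
    intro s
    rcases abs_choice (∑ i, sgn (s i) * a i) with h | h <;> rw [h]
    · exact le_add_of_nonneg_right (Real.exp_pos _).le
    · rw [mul_neg, neg_mul]; exact le_add_of_nonneg_left (Real.exp_pos _).le
  refine (Finset.sum_le_sum fun s _ => h3 s).trans ?_
  rw [Finset.sum_add_distrib]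
  rw [neg_sq] at h2
  linarith

section Symmetrization

variable {Z : Type*} {n : ℕ}

/-- The exponential of the largest deviation, over the class `F`, between a sample and a ghost
sample. -/
def expSupDeviation (F : Set (Z → ℝ)) (l : ℝ) (w : Fin n → Z × Z) : ENNReal :=
  ⨆ f ∈ F, ENNReal.ofReal (Real.exp (l * |∑ i, (f (w i).1 - f (w i).2)|))

/-- Exchange a sample point with its ghost where the sign is negative. -/
def swapAlong (s : Fin n → Bool) (w : Fin n → Z × Z) : Fin n → Z × Z :=
  fun i => if s i then (w i).swap else w i

/-- Swapping only flips signs in the difference pattern, so one set `A` serves all `s`, and the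
supremum is at most the sum over `A`. -/
lemma sum_expSupDeviation_swapAlong_le (F : Set (Z → ℝ)) (l N : ℝ) (w : Fin n → Z × Z)
    (A : Finset (Fin n → ℝ)) (hA : (A.card : ℝ) ≤ N) (hA2 : ∀ a ∈ A, ∀ i, |a i| ≤ 2)
    (hF : ∀ f ∈ F, (fun i => f (w i).1 - f (w i).2) ∈ A) :
    ∑ s : Fin n → Bool, expSupDeviation F l (swapAlong s w) ≤
      2 ^ n * ENNReal.ofReal (N * (2 * Real.exp (2 * n * l ^ 2))) := by
  have h1 : ∀ s : Fin n → Bool, expSupDeviation F l (swapAlong s w) ≤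
      ENNReal.ofReal (∑ a ∈ A, Real.exp (l * |∑ i, sgn (s i) * a i|)) := by
    intro s
    refine iSup₂_le fun f hf => ENNReal.ofReal_le_ofReal ?_
    have h2 : ∑ i, (f (swapAlong s w i).1 - f (swapAlong s w i).2) =
        ∑ i, sgn (s i) * (f (w i).1 - f (w i).2) := by
      refine Finset.sum_congr rfl fun i _ => ?_
      by_cases h : s i <;> simp [swapAlong, sgn, h]
    rw [h2]
    exact Finset.single_le_sum (f := fun a => Real.exp (l * |∑ i, sgn (s i) * a i|))
      (fun a _ => (Real.exp_pos _).le) (hF f hf)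
  refine (Finset.sum_le_sum fun s _ => h1 s).trans ?_
  rw [← ENNReal.ofReal_sum_of_nonneg fun s _ => Finset.sum_nonneg fun a _ => (Real.exp_pos _).le,
    Finset.sum_comm, show (2 : ENNReal) ^ n = ENNReal.ofReal (2 ^ n) by
      rw [ENNReal.ofReal_pow (by norm_num)]; simp, ← ENNReal.ofReal_mul (by positivity)]
  refine ENNReal.ofReal_le_ofReal ?_
  refine (Finset.sum_le_sum fun a ha => sum_exp_abs_sgn_le a (hA2 a ha) l).trans ?_
  rw [Finset.sum_const, nsmul_eq_mul, mul_left_comm]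
  gcongr

variable [MeasurableSpace Z]

lemma measurePreserving_swapAlong (P : Measure Z) [IsProbabilityMeasure P] (s : Fin n → Bool) :
    MeasurePreserving (swapAlong s) (Measure.pi fun _ : Fin n => P.prod P)
      (Measure.pi fun _ : Fin n => P.prod P) := by
  refine measurePreserving_pi (fun _ : Fin n => P.prod P) (fun _ : Fin n => P.prod P)
    (f := fun i p => if s i then p.swap else p) fun i => ?_
  cases s i
  · simpa using! MeasurePreserving.id (P.prod P)
  · simpa using! (Measure.measurePreserving_swap : MeasurePreserving Prod.swap (P.prod P) _)

variable [Countable Z] [DiscreteMeasurableSpace Z]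

/-- Swaps preserve the product measure, so the integral equals its average over all `2 ^ n` swaps,
which is bounded pointwise in `w`. -/
lemma lintegral_expSupDeviation_le (P : Measure Z) [IsProbabilityMeasure P] (F : Set (Z → ℝ))
    (l N : ℝ)
    (hF : ∀ w : Fin n → Z × Z, ∃ A : Finset (Fin n → ℝ), (A.card : ℝ) ≤ N ∧
      (∀ a ∈ A, ∀ i, |a i| ≤ 2) ∧ ∀ f ∈ F, (fun i => f (w i).1 - f (w i).2) ∈ A) :
    ∫⁻ w, expSupDeviation F l w ∂(Measure.pi fun _ : Fin n => P.prod P) ≤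
      ENNReal.ofReal (N * (2 * Real.exp (2 * n * l ^ 2))) := by
  have hsum : ∑ s : Fin n → Bool,
      ∫⁻ w, expSupDeviation F l (swapAlong s w) ∂(Measure.pi fun _ : Fin n => P.prod P) =
      2 ^ n * ∫⁻ w, expSupDeviation F l w ∂(Measure.pi fun _ : Fin n => P.prod P) := by
    rw [Finset.sum_congr rfl fun s _ =>
      (measurePreserving_swapAlong P s).lintegral_comp (Measurable.of_discrete)]
    simp
  have hle : 2 ^ n * ∫⁻ w, expSupDeviation F l w ∂(Measure.pi fun _ : Fin n => P.prod P) ≤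
      2 ^ n * ENNReal.ofReal (N * (2 * Real.exp (2 * n * l ^ 2))) := by
    rw [← hsum, ← lintegral_finsetSum _ fun s _ => Measurable.of_discrete]
    refine (lintegral_mono (g := fun _ => 2 ^ n * ENNReal.ofReal
      (N * (2 * Real.exp (2 * n * l ^ 2)))) fun w => ?_).trans_eq (by simp)
    obtain ⟨A, hA, hA2, hAF⟩ := hF w
    exact sum_expSupDeviation_swapAlong_le F l N w A hA hA2 hAF
  exact (ENNReal.mul_le_mul_iff_right (by simp) (by simp)).1 hle

/-- The ghost sample has the true mean as its expectation; Jensen's inequality moves the exponential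
inside. -/
lemma exp_deviation_le_lintegral (P : Measure Z) [IsProbabilityMeasure P] (f : Z → ℝ)
    (hf : ∀ z, |f z| ≤ 1) {l : ℝ} (hl : 0 ≤ l) (S : Fin n → Z) :
    ENNReal.ofReal (Real.exp (l * |∑ i, f (S i) - n * ∫ z, f z ∂P|)) ≤
      ∫⁻ S', ENNReal.ofReal (Real.exp (l * |∑ i, (f (S i) - f (S' i))|))
        ∂(Measure.pi fun _ : Fin n => P) := by
  set μ := Measure.pi fun _ : Fin n => P
  have hD : ∀ S' : Fin n → Z, |∑ i, (f (S i) - f (S' i))| ≤ n * 2 := by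
    intro S'
    refine (Finset.abs_sum_le_sum_abs _ _).trans ((Finset.sum_le_sum fun i _ =>
      (abs_sub _ _).trans (add_le_add (hf _) (hf _))).trans_eq ?_)
    rw [Finset.sum_const, Finset.card_univ, Fintype.card_fin, nsmul_eq_mul, one_add_one_eq_two]
  have hint : Integrable (fun S' : Fin n → Z => ∑ i, (f (S i) - f (S' i))) μ :=
    Integrable.of_bound (Measurable.of_discrete).aestronglyMeasurable (n * 2 : ℝ)
      (Filter.Eventually.of_forall hD)
  have hintexp : Integrable
      (fun S' : Fin n → Z => Real.exp (l * |∑ i, (f (S i) - f (S' i))|)) μ := by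
    refine Integrable.of_bound (Measurable.of_discrete).aestronglyMeasurable
      (Real.exp (l * (n * 2))) (Filter.Eventually.of_forall fun S' => ?_)
    rw [Real.norm_eq_abs, Real.abs_exp]
    exact Real.exp_le_exp.2 (mul_le_mul_of_nonneg_left (hD S') hl)
  have hmean : ∫ S', ∑ i, (f (S i) - f (S' i)) ∂μ = ∑ i, f (S i) - n * ∫ z, f z ∂P := by
    have hfi : ∀ i, Integrable (fun S' : Fin n → Z => f (S' i)) μ := fun i =>
      Integrable.of_bound (Measurable.of_discrete).aestronglyMeasurable 1
        (Filter.Eventually.of_forall fun S' => hf (S' i))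
    rw [integral_finsetSum _ fun i _ => by simpa using! (integrable_const (f (S i))).sub (hfi i)]
    have : ∀ i, ∫ S', (f (S i) - f (S' i)) ∂μ = f (S i) - ∫ z, f z ∂P := by
      intro i
      rw [integral_sub (integrable_const _) (hfi i)]
      simp only [integral_const, probReal_univ, one_smul, μ]
      rw [integral_comp_eval (μ := fun _ : Fin n => P) (i := i)
        (Measurable.of_discrete).aestronglyMeasurable]
    simp [this]
  rw [← ofReal_integral_eq_lintegral_ofReal hintexp
    (Filter.Eventually.of_forall fun _ => (Real.exp_pos _).le)]
  refine ENNReal.ofReal_le_ofReal ?_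
  have hjensen := convexOn_exp.map_integral_le (μ := μ)
    (f := fun S' : Fin n → Z => l * |∑ i, (f (S i) - f (S' i))|)
    Real.continuous_exp.continuousOn isClosed_univ (by simp) (hint.abs.const_mul l) hintexp
  refine le_trans (Real.exp_le_exp.2 ?_) hjensen
  rw [integral_const_mul, ← hmean]
  exact mul_le_mul_of_nonneg_left abs_integral_le_integral_abs hl

/-- Uniform deviation bound for a class of functions with values in `[-1, 1]` that realizes at
most `N` difference patterns on `n` pairs of points. -/
lemma measure_exists_deviation_le (P : Measure Z) [IsProbabilityMeasure P] (F : Set (Z → ℝ))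
    (hF1 : ∀ f ∈ F, ∀ z, |f z| ≤ 1) {l : ℝ} (hl : 0 ≤ l) (N r : ℝ)
    (hF : ∀ w : Fin n → Z × Z, ∃ A : Finset (Fin n → ℝ), (A.card : ℝ) ≤ N ∧
      (∀ a ∈ A, ∀ i, |a i| ≤ 2) ∧ ∀ f ∈ F, (fun i => f (w i).1 - f (w i).2) ∈ A) :
    (Measure.pi fun _ : Fin n => P) {S | ∃ f ∈ F, r ≤ |∑ i, f (S i) - n * ∫ z, f z ∂P|} ≤
      ENNReal.ofReal (2 * N * Real.exp (2 * n * l ^ 2 - l * r)) := by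
  set μ := Measure.pi fun _ : Fin n => P
  set c := ENNReal.ofReal (Real.exp (l * r)) with hc
  set G : (Fin n → Z) → ENNReal := fun S =>
    ∫⁻ S', expSupDeviation F l (fun i => (S i, S' i)) ∂μ with hG
  have hsub : {S | ∃ f ∈ F, r ≤ |∑ i, f (S i) - n * ∫ z, f z ∂P|} ⊆ {S | c ≤ G S} := by
    rintro S ⟨f, hf, hr⟩
    refine le_trans (ENNReal.ofReal_le_ofReal (Real.exp_le_exp.2
      (mul_le_mul_of_nonneg_left hr hl))) ((exp_deviation_le_lintegral P f (hF1 f hf) hl S).trans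
        (lintegral_mono fun S' => ?_))
    exact le_iSup₂_of_le f hf le_rfl
  have hGint : ∫⁻ S, G S ∂μ =
      ∫⁻ w, expSupDeviation F l w ∂(Measure.pi fun _ : Fin n => P.prod P) := by
    rw [← lintegral_prod (μ := μ) (ν := μ)
      (fun p => expSupDeviation F l (fun i => (p.1 i, p.2 i)))
      (Measurable.of_discrete).aemeasurable]
    exact ((measurePreserving_arrowProdEquivProdArrow Z Z (Fin n) (fun _ => P)
      (fun _ => P)).lintegral_comp (Measurable.of_discrete)).symm
  have hmarkov := mul_meas_ge_le_lintegral (μ := μ) (f := G) Measurable.of_discrete c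
  have hbound := (mul_le_mul_right (measure_mono hsub) c).trans (hmarkov.trans (hGint.trans_le
    (lintegral_expSupDeviation_le P F l N hF)))
  have hc0 : c ≠ 0 := by simp [hc, Real.exp_pos]
  refine (ENNReal.mul_le_mul_iff_right hc0 ENNReal.ofReal_ne_top).1 (hbound.trans_eq ?_)
  rw [hc, ← ENNReal.ofReal_mul (Real.exp_pos _).le, Real.exp_sub]
  congr 1
  field_simp

end Symmetrization

/-! ### Uniform convergence for losses that depend on a binary prediction -/

/-- The cost of predicting `h` instead of the constant `false`. -/
def excessLoss {X : Type*} (loss : X × Bool → Bool → ℝ) (h : X → Bool) (z : X × Bool) : ℝ :=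
  if h z.1 then loss z true - loss z false else 0

lemma loss_eq_add_excessLoss {X : Type*} (loss : X × Bool → Bool → ℝ) (h : X → Bool)
    (z : X × Bool) : loss z (h z.1) = loss z false + excessLoss loss h z := by
  by_cases hz : h z.1 = true <;> simp [excessLoss, hz]

lemma empiricalRisk_eq_add {X : Type*} {loss : X × Bool → Bool → ℝ} {n : ℕ}
    (S : Fin n → X × Bool) (h : X → Bool) :
    empiricalRisk loss S h =
      (1 / (n : ℝ)) * ∑ i, loss (S i) false + (1 / (n : ℝ)) * ∑ i, excessLoss loss h (S i) := by
  rw [← mul_add, ← Finset.sum_add_distrib]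
  simp only [empiricalRisk, loss_eq_add_excessLoss loss h]

lemma abs_excessLoss_le {X : Type*} {loss : X × Bool → Bool → ℝ}
    (hloss : ∀ z, |loss z true - loss z false| ≤ 1) (h : X → Bool) (z : X × Bool) :
    |excessLoss loss h z| ≤ 1 := by
  by_cases hz : h z.1 = true <;> simp [excessLoss, hz, hloss]

lemma exists_finset_excessLoss_patterns {X E : Type*} [AddCommGroup E] [Module ℝ E]
    [Module.Finite ℝ E] {H : Set (X → Bool)} (φ : X → E)
    (hH : ∀ h ∈ H, ∃ f : E →ₗ[ℝ] ℝ, ∀ x, h x = true ↔ 0 ≤ f (φ x))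
    {loss : X × Bool → Bool → ℝ} (hloss : ∀ z, |loss z true - loss z false| ≤ 1)
    {t : ℝ} (ht : 0 < t) (ht1 : t ≤ 1) {n : ℕ} (w : Fin n → (X × Bool) × (X × Bool)) :
    ∃ A : Finset (Fin n → ℝ),
      (A.card : ℝ) ≤ (1 / t) ^ Module.finrank ℝ E * Real.exp (2 * n * t) ∧
      (∀ a ∈ A, ∀ i, |a i| ≤ 2) ∧
      ∀ f ∈ excessLoss loss '' H, (fun i => f (w i).1 - f (w i).2) ∈ A := by
  classical
  -- The `2n` points of sample and ghost; a difference pattern depends on `h` only through its trace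
  -- on them.
  let x : Fin n × Bool → X := fun p => if p.2 then (w p.1).2.1 else (w p.1).1.1
  let g : X × Bool → ℝ := fun z => loss z true - loss z false
  let pattern : Finset (Fin n × Bool) → Fin n → ℝ := fun s i =>
    (if (i, false) ∈ s then g (w i).1 else 0) - (if (i, true) ∈ s then g (w i).2 else 0)
  refine ⟨(traces H x).image pattern, ?_, ?_, ?_⟩
  · have h1 := card_traces_le φ hH x ht ht1
    have h2 : (((traces H x).image pattern).card : ℝ) ≤ (traces H x).card := by
      exact_mod_cast Finset.card_image_le
    refine h2.trans (h1.trans_eq ?_)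
    simp [mul_comm]
  · intro a ha i
    obtain ⟨s, -, rfl⟩ := Finset.mem_image.1 ha
    have hg : ∀ (p : Prop) [Decidable p] (z : X × Bool), |if p then g z else 0| ≤ 1 := by
      intro p _ z
      split_ifs
      · exact hloss z
      · simp
    exact (abs_sub _ _).trans ((add_le_add (hg _ _) (hg _ _)).trans_eq one_add_one_eq_two)
  · rintro _ ⟨h, hh, rfl⟩
    refine Finset.mem_image.2 ⟨Finset.univ.filter fun p => h (x p) = true,
      mem_traces.2 ⟨h, hh, by simp⟩, ?_⟩
    ext i
    simp [pattern, excessLoss, x, g]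

section Risk

variable {X : Type*} [MeasurableSpace X] [Countable X] [DiscreteMeasurableSpace X]
  {P : Measure (X × Bool)} [IsProbabilityMeasure P] {loss : X × Bool → Bool → ℝ}

lemma expectedRisk_eq_add (hint : ∀ b, Integrable (fun z => loss z b) P)
    (hloss : ∀ z, |loss z true - loss z false| ≤ 1) (h : X → Bool) :
    expectedRisk loss P h = ∫ z, loss z false ∂P + ∫ z, excessLoss loss h z ∂P := by
  rw [← integral_add (hint false)]
  · exact integral_congr_ae (Filter.Eventually.of_forall (loss_eq_add_excessLoss loss h))
  · exact Integrable.of_bound (Measurable.of_discrete).aestronglyMeasurable 1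
      (Filter.Eventually.of_forall (abs_excessLoss_le hloss h))

lemma expectedRisk_le_add_one (hint : ∀ b, Integrable (fun z => loss z b) P)
    (hloss : ∀ z, |loss z true - loss z false| ≤ 1) (h g : X → Bool) :
    expectedRisk loss P h ≤ expectedRisk loss P g + 1 := by
  have hi : ∀ h : X → Bool, Integrable (fun z => loss z (h z.1)) P := by
    intro h
    simp only [loss_eq_add_excessLoss loss h]
    exact (hint false).add (Integrable.of_bound (Measurable.of_discrete).aestronglyMeasurable 1
      (Filter.Eventually.of_forall (abs_excessLoss_le hloss h)))
  have h1 : ∫ z, loss z (h z.1) ∂P ≤ ∫ z, (loss z (g z.1) + 1) ∂P := by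
    refine integral_mono (hi h) ((hi g).add (integrable_const 1)) fun z => ?_
    have := abs_le.1 (hloss z)
    cases h z.1 <;> cases g z.1 <;> simp only <;> linarith
  rw [integral_add (hi g) (integrable_const 1)] at h1
  simpa [expectedRisk] using h1

/-- A risk that no competitor beats by more than `ε` is `ε`-close to the optimal one. -/
lemma abs_expectedRisk_sub_le {H : Set (X → Bool)} (hint : ∀ b, Integrable (fun z => loss z b) P)
    (hloss : ∀ z, |loss z true - loss z false| ≤ 1) {ε : ℝ} (hε : 0 ≤ ε) {hhat : X → Bool}
    (hmem : hhat ∈ H) (hle : ∀ g ∈ H, expectedRisk loss P hhat ≤ expectedRisk loss P g + ε) :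
    |expectedRisk loss P hhat - sInf (expectedRisk loss P '' H)| ≤ ε ∧
      ∀ hstar, IsRiskMinimizer H (expectedRisk loss P) hstar →
        |expectedRisk loss P hhat - expectedRisk loss P hstar| ≤ ε := by
  have hbdd : BddBelow (expectedRisk loss P '' H) := by
    refine ⟨expectedRisk loss P hhat - 1, ?_⟩
    rintro _ ⟨g, -, rfl⟩
    linarith [expectedRisk_le_add_one hint hloss hhat g]
  refine ⟨abs_le.2 ⟨?_, ?_⟩, fun hstar hs => abs_le.2 ⟨?_, ?_⟩⟩
  · linarith [csInf_le hbdd (Set.mem_image_of_mem _ hmem)]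
  · have : expectedRisk loss P hhat - ε ≤ sInf (expectedRisk loss P '' H) := by
      refine le_csInf ⟨_, Set.mem_image_of_mem _ hmem⟩ ?_
      rintro _ ⟨g, hg, rfl⟩
      linarith [hle g hg]
    linarith
  · linarith [hs.2 hhat hmem]
  · linarith [hle hstar hs.1]

lemma expectedRisk_le_of_deviation_lt {H : Set (X → Bool)}
    (hint : ∀ b, Integrable (fun z => loss z b) P)
    (hloss : ∀ z, |loss z true - loss z false| ≤ 1) {ε : ℝ} {n : ℕ} (hn : 0 < n)
    {S : Fin n → X × Bool}
    (hS : ∀ h ∈ H, |∑ i, excessLoss loss h (S i) - n * ∫ z, excessLoss loss h z ∂P| < n * (ε / 2))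
    {hhat : X → Bool} (hmin : IsRiskMinimizer H (empiricalRisk loss S) hhat) {g : X → Bool}
    (hg : g ∈ H) : expectedRisk loss P hhat ≤ expectedRisk loss P g + ε := by
  have hn' : (0 : ℝ) < n := by exact_mod_cast hn
  have h1 := abs_lt.1 (hS hhat hmin.1)
  have h2 := abs_lt.1 (hS g hg)
  have h3 := hmin.2 g hg
  rw [empiricalRisk_eq_add, empiricalRisk_eq_add] at h3
  have h4 : ∑ i, excessLoss loss hhat (S i) ≤ ∑ i, excessLoss loss g (S i) :=
    le_of_mul_le_mul_left (by linarith) (one_div_pos.2 hn')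
  rw [expectedRisk_eq_add hint hloss, expectedRisk_eq_add hint hloss]
  have h5 : (n : ℝ) * ∫ z, excessLoss loss hhat z ∂P ≤
      n * (∫ z, excessLoss loss g z ∂P + ε) := by
    rw [mul_add]; linarith
  linarith [le_of_mul_le_mul_left h5 hn']

/-- Probability that some hypothesis of a class of half-spaces deviates by `ε / 2`. -/
lemma measure_deviation_halfspaces_le {E : Type*} [AddCommGroup E] [Module ℝ E]
    [Module.Finite ℝ E] {H : Set (X → Bool)} (φ : X → E)
    (hH : ∀ h ∈ H, ∃ f : E →ₗ[ℝ] ℝ, ∀ x, h x = true ↔ 0 ≤ f (φ x))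
    (hloss : ∀ z, |loss z true - loss z false| ≤ 1) {ε : ℝ} (hε : 0 < ε) (hε1 : ε ≤ 1) (n : ℕ) :
    (Measure.pi fun _ : Fin n => P) {S | ∃ h ∈ H, n * (ε / 2) ≤
      |∑ i, excessLoss loss h (S i) - n * ∫ z, excessLoss loss h z ∂P|} ≤
      ENNReal.ofReal (2 * (128 / ε ^ 2) ^ Module.finrank ℝ E * Real.exp (-(n * ε ^ 2 / 64))) := by
  have ht1 : ε ^ 2 / 128 ≤ 1 := by nlinarith
  -- With `l = ε / 8` the concentration exponent is `nε²/32 - nε²/16 = -nε²/32`; `t = ε² / 128`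
  -- makes the growth factor cost `nε²/64`, half of it.
  have h := measure_exists_deviation_le (n := n) P (excessLoss loss '' H)
    (by rintro _ ⟨h, -, rfl⟩; exact abs_excessLoss_le hloss h) (l := ε / 8) (by positivity)
    _ (n * (ε / 2))
    (exists_finset_excessLoss_patterns φ hH hloss (t := ε ^ 2 / 128) (by positivity) ht1)
  simp only [Set.exists_mem_image] at h
  refine h.trans_eq (congrArg _ ?_)
  rw [one_div_div, mul_assoc, mul_assoc, ← Real.exp_add, ← mul_assoc]
  congr 2
  ring

end Risk

/-! ### Weighted Chamfer classifiers -/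

/-- The average contribution of the token `t` to the Chamfer score. -/
def chamferFeature {T m : ℕ} (encQ encD : Encoder T m) (x : TokenSeq T × TokenSeq T)
    (t : Fin T) : ℝ :=
  (1 / (x.1.len : ℝ)) * ∑ i : Fin x.1.len,
    if x.1.token i = t then ⨅ j : Fin x.2.len, ‖encQ x.1 i - encD x.2 j‖ else 0

lemma weightedChamfer_eq_sum {T m : ℕ} (encQ encD : Encoder T m) (w : Fin T → ℝ)
    (q d : TokenSeq T) :
    weightedChamfer encQ encD w q d = ∑ t, w t * chamferFeature encQ encD (q, d) t := by
  simp only [weightedChamfer, chamferFeature, Finset.mul_sum]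
  rw [Finset.sum_comm]
  refine Finset.sum_congr rfl fun i _ => ?_
  simp [mul_left_comm]

lemma hypothesisClass_halfspaces {T m : ℕ} (encQ encD : Encoder T m) :
    ∀ h ∈ hypothesisClass encQ encD, ∃ f : (Fin T → ℝ) × ℝ →ₗ[ℝ] ℝ,
      ∀ x, h x = true ↔ 0 ≤ f (chamferFeature encQ encD x, 1) := by
  rintro h ⟨w, τ, hw⟩
  refine ⟨(∑ t, w t • LinearMap.proj t).comp (LinearMap.fst ℝ _ _) - τ • LinearMap.snd ℝ _ _, ?_⟩
  rintro ⟨q, d⟩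
  rw [hw, weightedChamfer_eq_sum]
  simp

lemma failure_probability_le {T n : ℕ} (hT : 1 ≤ T) {ε₀ ε δ : ℝ} (hε₀ : ε₀ < 1) (hε : 0 < ε)
    (hle : ε ≤ ε₀) (hδ : 0 < δ) (hδ1 : δ < 1)
    (hn : (n : ℝ) ≥ (11 / Real.log (1 / ε₀) + 5) * 64 *
      ((T * Real.log (1 / ε) + Real.log (1 / δ)) / ε ^ 2)) :
    2 * (128 / ε ^ 2) ^ (T + 1) * Real.exp (-(n * ε ^ 2 / 64)) ≤ δ := by
  have hε₀' : 0 < ε₀ := hε.trans_le hle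
  set c := Real.log (1 / ε₀) with hc
  set L := Real.log (1 / ε) with hL
  have hc0 : 0 < c := Real.log_pos (by rw [lt_div_iff₀ hε₀']; linarith)
  have hcL : c ≤ L := Real.log_le_log (by positivity) (one_div_le_one_div_of_le hε hle)
  have hT' : (1 : ℝ) ≤ T := by exact_mod_cast hT
  have hLδ : 0 < Real.log (1 / δ) := Real.log_pos (by rw [lt_div_iff₀ hδ]; linarith)
  have hlog2 : Real.log 2 ≤ 1 := by linarith [Real.log_two_lt_d9]
  have hlog128 : Real.log 128 ≤ 5 := by
    rw [show (128 : ℝ) = 2 ^ 7 by norm_num, Real.log_pow]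
    push_cast
    linarith [Real.log_two_lt_d9]
  have hlog : Real.log (2 * (128 / ε ^ 2) ^ (T + 1)) =
      Real.log 2 + (T + 1) * (Real.log 128 + 2 * L) := by
    rw [Real.log_mul (by norm_num) (by positivity), Real.log_pow,
      Real.log_div (by norm_num) (by positivity), Real.log_pow, hL, one_div, Real.log_inv]
    push_cast
    ring
  have hn' : (11 / c + 5) * (T * L + Real.log (1 / δ)) ≤ n * ε ^ 2 / 64 := by
    rw [ge_iff_le, ← mul_div_assoc, div_le_iff₀ (by positivity)] at hn
    linarith
  have h1 : 1 ≤ L / c := (one_le_div hc0).2 hcL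
  -- Uses `T + 1 ≤ 2 * T`, `log 2 ≤ 1` and `log 128 ≤ 5`, whence `11 = 1 + 2 * 5`.
  have h2 : Real.log 2 + (T + 1) * (Real.log 128 + 2 * L) ≤ T * (11 + 4 * L) := by
    nlinarith [mul_nonneg (sub_nonneg.2 hT') (hc0.le.trans hcL),
      mul_nonneg (sub_nonneg.2 hT') (sub_nonneg.2 hlog128)]
  -- `ε ≤ ε₀` gives `1 ≤ L / c`, so the constant 11 is absorbed into a multiple of `L`.
  have h3 : T * (11 + 4 * L) ≤ (11 / c + 5) * (T * L) := by
    have : (11 / c + 5) * (T * L) = T * (11 * (L / c) + 5 * L) := by ring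
    rw [this]
    exact mul_le_mul_of_nonneg_left (by linarith) (by linarith)
  have h4 : Real.log (1 / δ) ≤ (11 / c + 5) * Real.log (1 / δ) :=
    le_mul_of_one_le_left hLδ.le (by linarith [div_pos (by norm_num : (0 : ℝ) < 11) hc0])
  rw [← Real.exp_log (by positivity : 0 < 2 * (128 / ε ^ 2) ^ (T + 1)), ← Real.exp_add,
    ← Real.le_log_iff_exp_le hδ, hlog]
  have h5 : Real.log (1 / δ) = -Real.log δ := by rw [one_div, Real.log_inv]
  linarith

end WeightedChamfer

end

theorem mainTheorem4 (ε₀ : ℝ) (hε₀ : ε₀ < 1) :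
    ∃ C : ℝ, 0 < C ∧
      ∀ (T m : ℕ) (encQ encD : WeightedChamfer.Encoder T m)
        (P : MeasureTheory.Measure
          ((WeightedChamfer.TokenSeq T × WeightedChamfer.TokenSeq T) × Bool))
        [MeasureTheory.IsProbabilityMeasure P]
        (loss : (WeightedChamfer.TokenSeq T × WeightedChamfer.TokenSeq T) × Bool → Bool → ℝ)
        -- the risk is defined, and the loss is 1-Lipschitz in the prediction
        (_ : ∀ b, MeasureTheory.Integrable (fun z => loss z b) P)
        (_ : ∀ z, |loss z true - loss z false| ≤ 1)
        (ε δ : ℝ) (_ : 0 < ε) (_ : ε ≤ ε₀ ∨ 1 ≤ ε) (_ : 0 < δ) (_ : δ < 1)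
        (n : ℕ) (_ : (n : ℝ) ≥ C * ((T * Real.log (1 / ε) + Real.log (1 / δ)) / ε ^ 2)),
        MeasureTheory.Measure.pi (fun _ : Fin n => P)
          {S | ∀ hhat, WeightedChamfer.IsRiskMinimizer (WeightedChamfer.hypothesisClass encQ encD)
                (WeightedChamfer.empiricalRisk loss S) hhat →
              |WeightedChamfer.expectedRisk loss P hhat -
                  sInf (WeightedChamfer.expectedRisk loss P ''
                    WeightedChamfer.hypothesisClass encQ encD)| ≤ ε ∧
              ∀ hstar, WeightedChamfer.IsRiskMinimizer (WeightedChamfer.hypothesisClass encQ encD)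
                  (WeightedChamfer.expectedRisk loss P) hstar →
                |WeightedChamfer.expectedRisk loss P hhat -
                  WeightedChamfer.expectedRisk loss P hstar| ≤ ε}
          ≥ ENNReal.ofReal (1 - δ) := by
  -- The absolute value keeps the constant positive when `ε₀ ≤ 0`, where the case `ε ≤ ε₀` is empty.
  refine ⟨(11 / |Real.log (1 / ε₀)| + 5) * 64, by positivity, ?_⟩
  intro T m encQ encD P hP loss hint hloss ε δ hε hεε₀ hδ hδ1 n hn
  rcases hεε₀ with hle | hge
  · have hε₀' : 0 < ε₀ := hε.trans_le hle
    have hlog : 0 < Real.log (1 / ε₀) :=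
      Real.log_pos (by rw [lt_div_iff₀ hε₀']; linarith)
    rw [abs_of_pos hlog] at hn
    -- A probability measure needs a point, and no nonempty token sequence exists over an empty
    -- universe.
    have hT : 1 ≤ T := by
      obtain ⟨⟨⟨q, _⟩, _⟩⟩ := P.nonempty_of_neZero
      obtain ⟨t, _⟩ := List.exists_mem_of_ne_nil q.1 q.2
      exact Nat.one_le_iff_ne_zero.2 fun h => (h ▸ t).elim0
    have hn0 : 0 < n := by
      have h1 : 0 < Real.log (1 / ε) :=
        Real.log_pos (by rw [lt_div_iff₀ hε]; linarith)
      have h2 : 0 < Real.log (1 / δ) := Real.log_pos (by rw [lt_div_iff₀ hδ]; linarith)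
      have h3 : (0 : ℝ) < n := lt_of_lt_of_le (by positivity) hn
      exact_mod_cast h3
    have hbad := WeightedChamfer.measure_deviation_halfspaces_le (P := P) (loss := loss)
      (fun x => (WeightedChamfer.chamferFeature encQ encD x, (1 : ℝ)))
      (WeightedChamfer.hypothesisClass_halfspaces encQ encD) hloss hε (by linarith) n
    rw [show Module.finrank ℝ ((Fin T → ℝ) × ℝ) = T + 1 by simp] at hbad
    have hbadδ := hbad.trans (ENNReal.ofReal_le_ofReal
      (WeightedChamfer.failure_probability_le hT hε₀ hε hle hδ hδ1 hn))
    rw [ge_iff_le, ENNReal.ofReal_sub _ hδ.le, ENNReal.ofReal_one]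
    refine (tsub_le_tsub_left hbadδ 1).trans ?_
    rw [← MeasureTheory.prob_compl_eq_one_sub (MeasurableSet.of_discrete)]
    refine MeasureTheory.measure_mono fun S hS hhat hmin => ?_
    simp only [Set.mem_compl_iff, Set.mem_ofPred_eq, not_exists, not_and, not_le] at hS
    exact WeightedChamfer.abs_expectedRisk_sub_le hint hloss hε.le hmin.1 fun g hg =>
      WeightedChamfer.expectedRisk_le_of_deviation_lt hint hloss hn0 hS hmin hg
  · refine (ENNReal.ofReal_le_one.2 (by linarith)).trans_eq ?_
    rw [← MeasureTheory.measure_univ (μ := MeasureTheory.Measure.pi fun _ : Fin n => P)]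
    refine congrArg _ (Set.eq_univ_of_forall fun S hhat hmin => ?_).symm
    exact WeightedChamfer.abs_expectedRisk_sub_le hint hloss hε.le hmin.1 fun g _ =>
      (WeightedChamfer.expectedRisk_le_add_one hint hloss hhat g).trans (by linarith)
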